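/- **Setting.** Let $d\ge 1$, let $\Omega\subset\mathbb{R}^d$ be a bounded open set (for instance a bounded Lipschitz domain), let $\alpha>0$, and let $W=\{w_1,\dots,w_M\}\subset\mathbb{Z}$ with pairwise distinct $w_i$. Let $\mathrm{BV}_W(\Omega)$ be the set of all $w\in \mathrm{BV}(\Omega)$ (that is, $w\in L^1(\Omega)$ and the distributional derivative $Dw$ is a finite $\mathbb{R}^d$-valued Radon measure on $\Omega$) such that $w(x)\in W$ for a.e. $x\in\Omega$. For a set $E\subset\Omega$ whose characteristic function has a distributional derivative $D\chi_E$ that is a finite Radon measure on $\Omega$, the reduced boundary $\partial^*E$ (relative to $\Omega$) is the set of all $x\in\Omega\cap\operatorname{supp}|D\chi_E|$ for which the limit $$n_E(x):=-\lim_{r\downarrow 0}\frac{D\chi_E(B_r(x))}{|D\chi_E|(B_r(x))}$$ exists and has Euclidean norm $1$; $n_E$ is the unit outer normal. For $\phi\in C_c^\infty(\Omega,\mathbb{R}^d)$ put $\operatorname{div}_E\phi:=\operatorname{div}\phi-n_E\cdot\nabla\phi\, n_E$ on $\partial^*E$. Let $F:L^1(\Omega)\to\mathbb{R}$ be continuously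 Fréchet differentiable and let $\bar w\in \mathrm{BV}_W(\Omega)$ be such that $F'(\bar w)\in L^1(\Omega)^*$ is represented by a function $\nabla F(\bar w)\in C(\overline\Omega)$. Let $E_i:=\{x\in\Omega : \bar w(x)=w_i\}$, $i=1,\dots,M$, be the level sets of $\bar w$. For a vector field $\phi\in C_c^\infty(\Omega,\mathbb{R}^d)$ consider the identity $$\sum_{i=1}^{M-1}\sum_{j=i+1}^{M}\int_{\partial^*E_i\cap\partial^*E_j}(w_j-w_i)\,\nabla F(\bar w)(x)\,\phi(x)\cdot n_{E_i}(x)-\alpha|w_i-w_j|\operatorname{div}_{E_i}\phi(x)\,d\mathcal{H}^{d-1}(x)=0, \qquad (*)$$ where $\mathcal{H}^{d-1}$ is the $(d-1)$-dimensional Hausdorff measure and where it is understood as part of $(*)$ that the integrals exist, i.e. that the integrands are $\mathcal{H}^{d-1}$-integrable on $\partial^*E_i\cap\partial^*E_j$ for all $i<j$. The function $\bar w$ is *stationary* if $(*)$ holds for all $\phi\in C_c^\infty(\Omega,\mathbb{R}^d)$. Let $\mathcal{D}$ be a finite family of open subsets of $\Omega$ that covers $\Omega$. The function $\bar w$ is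 *patch-stationary with respect to $\mathcal{D}$* if, for every $D\in\mathcal{D}$, $(*)$ holds for all $\phi\in C_c^\infty(D,\mathbb{R}^d)$. **Theorem.** The function $\bar w$ is stationary if and only if it is patch-stationary with respect to $\mathcal{D}$. -/

import Mathlib

open MeasureTheory Filter Topology
open scoped ENNReal ContDiff

noncomputable section

namespace BVControl

/-- `d`-dimensional Euclidean space. -/
abbrev Eucl (d : ℕ) : Type := EuclideanSpace ℝ (Fin d)

/-- The divergence `∑ k, ∂_k φ_k` of a vector field. -/
def divergence {d : ℕ} (φ : Eucl d → Eucl d) (x : Eucl d) : ℝ :=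
  ∑ k : Fin d, (fderiv ℝ φ x (EuclideanSpace.single k 1)) k

/-- `φ ∈ C_c^∞(U, ℝ^d)`, with `φ` extended by zero to all of `ℝ^d`. -/
def IsTestField {d : ℕ} (U : Set (Eucl d)) (φ : Eucl d → Eucl d) : Prop :=
  ContDiff ℝ ∞ φ ∧ HasCompactSupport φ ∧ tsupport φ ⊆ U

/-- The finite `ℝ^d`-valued Borel measure `ν`, concentrated on `Ω`, is the distributional
derivative `Du` of `u` on `Ω`: `∫_Ω u div φ dx = - ∫ φ · dν` for all `φ ∈ C_c^∞(Ω, ℝ^d)`. -/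
def IsDistribDeriv {d : ℕ} (Ω : Set (Eucl d)) (u : Eucl d → ℝ)
    (ν : VectorMeasure (Eucl d) (Eucl d)) : Prop :=
  (∀ A : Set (Eucl d), MeasurableSet A → ν A = ν (A ∩ Ω)) ∧
  ∀ φ : Eucl d → Eucl d, IsTestField Ω φ →
    ∫ x in Ω, u x * divergence φ x = - ∫ᵛ x, φ x ∂[innerSL ℝ; ν]

/-- `u ∈ BV(Ω)`: `u ∈ L¹(Ω)` and `Du` is a finite `ℝ^d`-valued Radon measure on `Ω`. -/
def IsBV {d : ℕ} (Ω : Set (Eucl d)) (u : Eucl d → ℝ) : Prop :=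
  IntegrableOn u Ω ∧ ∃ ν : VectorMeasure (Eucl d) (Eucl d), IsDistribDeriv Ω u ν

/-- `w ∈ BV_W(Ω)` for `W = {W 0, …, W (M - 1)} ⊆ ℤ`. -/
def IsBVW {d M : ℕ} (Ω : Set (Eucl d)) (W : Fin M → ℤ) (w : Eucl d → ℝ) : Prop :=
  IsBV Ω w ∧ ∀ᵐ x ∂(volume.restrict Ω), ∃ i : Fin M, w x = (W i : ℝ)

open Classical in
/-- The measure `Du` on `Ω` (it is unique; the value is `0` if it does not exist). -/
def distribDeriv {d : ℕ} (Ω : Set (Eucl d)) (u : Eucl d → ℝ) :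
    VectorMeasure (Eucl d) (Eucl d) :=
  if h : ∃ ν : VectorMeasure (Eucl d) (Eucl d), IsDistribDeriv Ω u ν then h.choose else 0

/-- The measure `Dχ_E` on `Ω`. -/
def perimeterMeasure {d : ℕ} (Ω E : Set (Eucl d)) : VectorMeasure (Eucl d) (Eucl d) :=
  distribDeriv Ω (E.indicator fun _ => (1 : ℝ))

/-- `n` is the measure-theoretic unit outer normal of `E` at `x`: the point `x` lies in the support
of `|Dχ_E|` and `- Dχ_E(B_r(x)) / |Dχ_E|(B_r(x))` tends to the unit vector `n` as `r ↓ 0`. -/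
def IsOuterNormal {d : ℕ} (Ω E : Set (Eucl d)) (x n : Eucl d) : Prop :=
  (∀ r : ℝ, 0 < r → 0 < (perimeterMeasure Ω E).variation (Metric.ball x r)) ∧
  ‖n‖ = 1 ∧
  Tendsto (fun r : ℝ =>
      -(((perimeterMeasure Ω E).variation (Metric.ball x r)).toReal⁻¹ •
        perimeterMeasure Ω E (Metric.ball x r))) (𝓝[>] 0) (𝓝 n)

/-- The reduced boundary `∂*E`, relative to `Ω`. -/
def reducedBoundary {d : ℕ} (Ω E : Set (Eucl d)) : Set (Eucl d) :=
  {x | x ∈ Ω ∧ ∃ n : Eucl d, IsOuterNormal Ω E x n}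

open Classical in
/-- The unit outer normal `n_E : ∂*E → ℝ^d` (with value `0` where it does not exist). -/
def outerNormal {d : ℕ} (Ω E : Set (Eucl d)) (x : Eucl d) : Eucl d :=
  if h : ∃ n : Eucl d, IsOuterNormal Ω E x n then h.choose else 0

/-- The boundary divergence `div_E φ = div φ - n_E · ∇φ n_E`. -/
def boundaryDivergence {d : ℕ} (Ω E : Set (Eucl d)) (φ : Eucl d → Eucl d) (x : Eucl d) : ℝ :=
  divergence φ x - inner ℝ (outerNormal Ω E x) (fderiv ℝ φ x (outerNormal Ω E x))

/-- The level set `{w = a}` in `Ω`. -/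
def levelSet {d : ℕ} (Ω : Set (Eucl d)) (w : Eucl d → ℝ) (a : ℤ) : Set (Eucl d) :=
  {x | x ∈ Ω ∧ w x = (a : ℝ)}

/-- The interface `∂*E_i ∩ ∂*E_j` between the level sets `E_i = {w = W i}`, `E_j = {w = W j}`. -/
def interface {d M : ℕ} (Ω : Set (Eucl d)) (W : Fin M → ℤ) (w : Eucl d → ℝ) (i j : Fin M) :
    Set (Eucl d) :=
  reducedBoundary Ω (levelSet Ω w (W i)) ∩ reducedBoundary Ω (levelSet Ω w (W j))

/-- The integrand `(w_j - w_i) g φ · n_{E_i} - α |w_i - w_j| div_{E_i} φ`. -/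
def interfaceIntegrand {d M : ℕ} (Ω : Set (Eucl d)) (W : Fin M → ℤ) (w : Eucl d → ℝ)
    (g : Eucl d → ℝ) (α : ℝ) (φ : Eucl d → Eucl d) (i j : Fin M) (x : Eucl d) : ℝ :=
  ((W j : ℝ) - (W i : ℝ)) * g x * inner ℝ (φ x) (outerNormal Ω (levelSet Ω w (W i)) x)
    - α * |(W i : ℝ) - (W j : ℝ)| * boundaryDivergence Ω (levelSet Ω w (W i)) φ x

/-- The first-variation identity for the field `φ`: the interface integrals with respect to the
`(d-1)`-dimensional Hausdorff measure exist and their sum over `i < j` vanishes. -/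
def FirstVariationIdentity {d M : ℕ} (Ω : Set (Eucl d)) (W : Fin M → ℤ) (w : Eucl d → ℝ)
    (g : Eucl d → ℝ) (α : ℝ) (φ : Eucl d → Eucl d) : Prop :=
  (∀ i j : Fin M, i < j →
    IntegrableOn (interfaceIntegrand Ω W w g α φ i j) (interface Ω W w i j)
      (Measure.euclideanHausdorffMeasure (d - 1))) ∧
  ∑ i : Fin M, ∑ j ∈ Finset.Ioi i,
    ∫ x in interface Ω W w i j, interfaceIntegrand Ω W w g α φ i j x
      ∂(Measure.euclideanHausdorffMeasure (d - 1)) = 0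

/-- `∇F(w) = g ∈ C(closure Ω)`: the continuous function `g` on the closure of `Ω` represents the
Fréchet derivative of `F` at `w ∈ L¹(Ω)`. -/
def IsContinuousGradient {d : ℕ} (Ω : Set (Eucl d))
    (F : Lp ℝ 1 (volume.restrict Ω) → ℝ) (w : Lp ℝ 1 (volume.restrict Ω))
    (g : Eucl d → ℝ) : Prop :=
  ContinuousOn g (closure Ω) ∧
  ∀ v : Lp ℝ 1 (volume.restrict Ω), fderiv ℝ F w v = ∫ x in Ω, g x * v x

/-- `w` is stationary, where `g = ∇F(w)`. -/
def Stationary {d M : ℕ} (Ω : Set (Eucl d)) (W : Fin M → ℤ) (w : Eucl d → ℝ)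
    (g : Eucl d → ℝ) (α : ℝ) : Prop :=
  ∀ φ : Eucl d → Eucl d, IsTestField Ω φ → FirstVariationIdentity Ω W w g α φ

/-- `w` is patch-stationary with respect to the family of patches `𝒟`, where `g = ∇F(w)`. -/
def PatchStationary {d M : ℕ} (Ω : Set (Eucl d)) (𝒟 : Set (Set (Eucl d))) (W : Fin M → ℤ)
    (w : Eucl d → ℝ) (g : Eucl d → ℝ) (α : ℝ) : Prop :=
  ∀ D ∈ 𝒟, ∀ φ : Eucl d → Eucl d, IsTestField D φ → FirstVariationIdentity Ω W w g α φ

end BVControl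

end

namespace BVControl

variable {d M : ℕ}

/-! The first-variation identity is linear in the field: normals, interfaces and gradient do not
depend on `φ`, and the integrand involves only `φ` and its first derivatives. Hence the
differentiable fields satisfying it are closed under finite sums (`FirstVariationIdentity.sum`). A
smooth partition of unity on the support of a test field, subordinate to the patches, splits the
field into finitely many test fields, each supported in one patch (`IsTestField.exists_sum_eq`).
This localizes stationarity; the converse only uses that patches lie in `Ω`. -/

lemma IsTestField.differentiable {U : Set (Eucl d)} {φ : Eucl d → Eucl d}
    (hφ : IsTestField U φ) : Differentiable ℝ φ :=
  hφ.1.differentiable (by simp)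

lemma IsTestField.mono {U V : Set (Eucl d)} (hUV : U ⊆ V) {φ : Eucl d → Eucl d}
    (hφ : IsTestField U φ) : IsTestField V φ :=
  ⟨hφ.1, hφ.2.1, hφ.2.2.trans hUV⟩

lemma divergence_zero (x : Eucl d) : divergence (0 : Eucl d → Eucl d) x = 0 := by
  simp [divergence]

lemma divergence_add {φ ψ : Eucl d → Eucl d} {x : Eucl d} (hφ : DifferentiableAt ℝ φ x)
    (hψ : DifferentiableAt ℝ ψ x) :
    divergence (φ + ψ) x = divergence φ x + divergence ψ x := by
  simp [divergence, fderiv_add hφ hψ, Finset.sum_add_distrib]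

lemma boundaryDivergence_zero (Ω E : Set (Eucl d)) (x : Eucl d) :
    boundaryDivergence Ω E 0 x = 0 := by
  simp [boundaryDivergence, divergence_zero]

lemma boundaryDivergence_add (Ω E : Set (Eucl d)) {φ ψ : Eucl d → Eucl d} {x : Eucl d}
    (hφ : DifferentiableAt ℝ φ x) (hψ : DifferentiableAt ℝ ψ x) :
    boundaryDivergence Ω E (φ + ψ) x =
      boundaryDivergence Ω E φ x + boundaryDivergence Ω E ψ x := by
  simp only [boundaryDivergence, divergence_add hφ hψ, fderiv_add hφ hψ,
    add_apply, inner_add_right]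
  ring

section Interface

variable (Ω : Set (Eucl d)) (W : Fin M → ℤ) (w g : Eucl d → ℝ) (α : ℝ)

lemma interfaceIntegrand_zero (i j : Fin M) : interfaceIntegrand Ω W w g α 0 i j = 0 := by
  ext x
  simp [interfaceIntegrand, boundaryDivergence_zero]

lemma interfaceIntegrand_add {φ ψ : Eucl d → Eucl d} (hφ : Differentiable ℝ φ)
    (hψ : Differentiable ℝ ψ) (i j : Fin M) :
    interfaceIntegrand Ω W w g α (φ + ψ) i j =
      interfaceIntegrand Ω W w g α φ i j + interfaceIntegrand Ω W w g α ψ i j := by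
  ext x
  simp only [interfaceIntegrand, boundaryDivergence_add _ _ (hφ x) (hψ x), Pi.add_apply,
    inner_add_left]
  ring

lemma FirstVariationIdentity.zero : FirstVariationIdentity Ω W w g α 0 := by
  simp only [FirstVariationIdentity, interfaceIntegrand_zero, Pi.zero_apply, integral_zero,
    Finset.sum_const_zero, and_true]
  exact fun _ _ _ => integrableOn_zero

variable {Ω W w g α}

/-- Existence of the integrals is part of the identity, and this is what makes the Bochner integrals
additive on each interface. -/
lemma FirstVariationIdentity.add {φ ψ : Eucl d → Eucl d} (hφd : Differentiable ℝ φ)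
    (hψd : Differentiable ℝ ψ) (hφ : FirstVariationIdentity Ω W w g α φ)
    (hψ : FirstVariationIdentity Ω W w g α ψ) :
    FirstVariationIdentity Ω W w g α (φ + ψ) := by
  refine ⟨fun i j hij => ?_, ?_⟩
  · rw [interfaceIntegrand_add Ω W w g α hφd hψd]
    exact (hφ.1 i j hij).add (hψ.1 i j hij)
  -- The right-hand side becomes `0 + 0`, and each zero is replaced by the vanishing sum for `φ` or
  -- `ψ`, so that both sides compare term by term.
  · rw [← add_zero (0 : ℝ)]
    nth_rewrite 2 [← hψ.2]
    rw [← hφ.2]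
    simp only [← Finset.sum_add_distrib]
    refine Finset.sum_congr rfl fun i _ => Finset.sum_congr rfl fun j hj => ?_
    have hij : i < j := Finset.mem_Ioi.mp hj
    rw [interfaceIntegrand_add Ω W w g α hφd hψd]
    exact integral_add' (hφ.1 i j hij) (hψ.1 i j hij)

lemma FirstVariationIdentity.sum {ι : Type*} (s : Finset ι) {φ : ι → Eucl d → Eucl d}
    (hd : ∀ i ∈ s, Differentiable ℝ (φ i))
    (hφ : ∀ i ∈ s, FirstVariationIdentity Ω W w g α (φ i)) :
    FirstVariationIdentity Ω W w g α (∑ i ∈ s, φ i) := by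
  -- Differentiability is carried through the induction because adding two fields requires it of the
  -- partial sums.
  refine (Finset.sum_induction φ
    (fun ψ => Differentiable ℝ ψ ∧ FirstVariationIdentity Ω W w g α ψ) ?_ ?_ ?_).2
  · exact fun ψ₁ ψ₂ h₁ h₂ => ⟨h₁.1.add h₂.1, h₁.2.add h₁.1 h₂.1 h₂.2⟩
  · exact ⟨differentiable_const 0, FirstVariationIdentity.zero Ω W w g α⟩
  · exact fun i hi => ⟨hd i hi, hφ i hi⟩

end Interface

/-- A finite open cover of a closed set has a subordinate smooth partition of unity. -/
lemma exists_contDiff_sum_eq_one {E : Type*} [NormedAddCommGroup E] [NormedSpace ℝ E]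
    [FiniteDimensional ℝ E] {ι : Type*} [Fintype ι] {K : Set E} (hK : IsClosed K)
    {V : ι → Set E} (hV : ∀ i, IsOpen (V i)) (hKV : K ⊆ ⋃ i, V i) :
    ∃ η : ι → E → ℝ, (∀ i, ContDiff ℝ ∞ (η i)) ∧ (∀ i, tsupport (η i) ⊆ V i) ∧
      ∀ x ∈ K, ∑ i, η i x = 1 := by
  obtain ⟨η, hη⟩ := SmoothPartitionOfUnity.exists_isSubordinate (modelWithCornersSelf ℝ E)
    hK V hV hKV
  refine ⟨fun i => η i, fun i => (η i).contMDiff.contDiff, hη, fun x hx => ?_⟩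
  rw [← finsum_eq_sum_of_fintype, η.sum_eq_one hx]

/-- A test field whose support is covered by finitely many open sets is a sum of test fields
supported in these sets. -/
lemma IsTestField.exists_sum_eq {U : Set (Eucl d)} {ι : Type*} [Fintype ι]
    {V : ι → Set (Eucl d)} (hV : ∀ i, IsOpen (V i)) (hUV : U ⊆ ⋃ i, V i)
    {φ : Eucl d → Eucl d} (hφ : IsTestField U φ) :
    ∃ ψ : ι → Eucl d → Eucl d, (∀ i, IsTestField (V i) (ψ i)) ∧ ∑ i, ψ i = φ := by
  obtain ⟨η, hη, hηV, hη1⟩ :=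
    exists_contDiff_sum_eq_one (isClosed_tsupport φ) hV (hφ.2.2.trans hUV)
  refine ⟨fun i x => η i x • φ x, fun i => ⟨(hη i).smul hφ.1, ?_, ?_⟩, ?_⟩
  -- Compactness of the support comes from `φ`, its location in `V i` from the cutoff `η i`.
  · exact HasCompactSupport.smul_left (f := η i) hφ.2.1
  · exact (tsupport_smul_subset_left (η i) φ).trans (hηV i)
  · ext1 x
    rw [Finset.sum_apply, ← Finset.sum_smul]
    -- The cutoffs need to sum to one only on the support of `φ`; elsewhere both sides vanish.
    by_cases hx : x ∈ tsupport φ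
    · rw [hη1 x hx, one_smul]
    · rw [image_eq_zero_of_notMem_tsupport hx, smul_zero]

end BVControl

theorem mainTheorem1 {d M : ℕ} (hd : 1 ≤ d)
    (Ω : Set (BVControl.Eucl d)) (hΩ : IsOpen Ω) (hΩb : Bornology.IsBounded Ω)
    (α : ℝ) (hα : 0 < α)
    (W : Fin M → ℤ) (hW : Function.Injective W)
    (𝒟 : Set (Set (BVControl.Eucl d))) (h𝒟fin : 𝒟.Finite)
    (h𝒟open : ∀ D ∈ 𝒟, IsOpen D) (h𝒟sub : ∀ D ∈ 𝒟, D ⊆ Ω) (h𝒟cov : Ω ⊆ ⋃₀ 𝒟)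
    (F : Lp ℝ 1 (volume.restrict Ω) → ℝ) (hF : ContDiff ℝ 1 F)
    (w : Lp ℝ 1 (volume.restrict Ω)) (hw : BVControl.IsBVW Ω W w)
    (g : BVControl.Eucl d → ℝ) (hg : BVControl.IsContinuousGradient Ω F w g) :
    BVControl.Stationary Ω W w g α ↔ BVControl.PatchStationary Ω 𝒟 W w g α := by
  refine ⟨fun h D hD φ hφ => h φ (hφ.mono (h𝒟sub D hD)), fun h φ hφ => ?_⟩
  have := h𝒟fin.fintype
  obtain ⟨ψ, hψ, rfl⟩ := hφ.exists_sum_eq (V := fun D : 𝒟 => (D : Set (BVControl.Eucl d)))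
    (fun D => h𝒟open D D.2) (by rwa [← Set.sUnion_eq_iUnion])
  exact .sum _ (fun D _ => (hψ D).differentiable) fun D _ => h D D.2 _ (hψ D)
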